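/- **Proposition 1.9.** Let $\mu$ and $\lambda$ be infinite cardinals. Assume that (a) $\mu=\mu^{\aleph_0}$ and $\lambda\le 2^{\mu}$; (b) $\mathfrak B$ is a complete Boolean algebra satisfying the countable chain condition (every family of pairwise disjoint nonzero elements is countable); (c) $x_i\in\mathfrak B\setminus\{0\}$ for $i<\lambda$, and $\mathcal S$ is a family of countable subsets of $\lambda$ such that $x_i\notin\mathfrak B_u$ whenever $u\in\mathcal S$ and $i\in\lambda\setminus u$; here, for countable $u\subseteq\lambda$, $\mathfrak B_u$ denotes the complete subalgebra of $\mathfrak B$ generated by $\{x_i:i\in u\}$ (the least subalgebra of $\mathfrak B$ containing these elements and closed under all suprema of $\mathfrak B$); (d)$^-$ whenever $\langle u_i:i<\lambda\rangle$ is a sequence of countable subsets of $\lambda$ with $i\in u_i$ for all $i<\lambda$, there are $n<\omega$, $i_0<\dots<i_{n-1}<\lambda$ and $u\in\mathcal S$ such that (i) $\bigcap_{\ell<n}x_{i_\ell}=0$ in $\mathfrak B$, (ii) $i_\ell\in u_{i_\ell}\setminus u$ for all $\ell<n$, and (iii) the sets $u_{i_\ell}\setminus u$ $(\ell<n)$ are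 pairwise disjoint; (e) if $u\in\mathcal S$, $i\in\lambda\setminus u$ and $y\in\mathfrak B_u\setminus\{0,1\}$, then $y\cap x_i\ne 0$ and $y-x_i\ne 0$. Then there are a proper $\sigma$-ideal $I$ of $\mathcal P(\mu)$ (so $\mu\notin I$) and a $\sigma$-algebra $\mathfrak A\supseteq I$ of subsets of $\mu$ such that the quotient Boolean algebra $\mathfrak A/I$ satisfies the countable chain condition and the natural homomorphism $\pi:\mathfrak A\to\mathfrak A/I$ cannot be lifted, i.e. there is no homomorphism of Boolean algebras $g:\mathfrak A/I\to\mathfrak A$ with $\pi\circ g=\mathrm{id}$. -/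

import Mathlib

open Cardinal
open scoped MeasureTheory

universe u v w

/-- The countable chain condition: every family of pairwise disjoint nonzero elements of the
Boolean algebra `B` is countable. -/
def BoolCCC (B : Type*) [BooleanAlgebra B] : Prop :=
  ∀ A : Set B, ⊥ ∉ A → A.PairwiseDisjoint id → A.Countable

/-- A Boolean subalgebra of a complete Boolean algebra is a complete subalgebra if it is closed
under arbitrary suprema computed in the ambient algebra (hence, by complementation, under
arbitrary infima). -/
def IsCompleteSubalgebra {B : Type*} [CompleteBooleanAlgebra B] (C : BooleanSubalgebra B) :
    Prop :=
  ∀ T : Set B, T ⊆ (C : Set B) → sSup T ∈ C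

/-- The complete subalgebra generated by `X`, that is, the completion inside `B` of the
subalgebra generated by `X`: the least complete subalgebra of `B` that contains `X`. -/
def completeClosure {B : Type*} [CompleteBooleanAlgebra B] (X : Set B) : BooleanSubalgebra B :=
  sInf {C : BooleanSubalgebra B | IsCompleteSubalgebra C ∧ X ⊆ (C : Set B)}

section IdealQuotient

variable {α : Type*} [BooleanAlgebra α] (J : Order.Ideal α)

theorem Order.Ideal.symmDiff_trans_mem {a b c : α} (h₁ : symmDiff a b ∈ J)
    (h₂ : symmDiff b c ∈ J) : symmDiff a c ∈ J :=
  J.lower (symmDiff_triangle a b c) (Order.Ideal.sup_mem h₁ h₂)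

/-- Congruence modulo the ideal `J`: the symmetric difference belongs to `J`. -/
def idealSetoid : Setoid α where
  r a b := symmDiff a b ∈ J
  iseqv :=
    { refl := fun a => by rw [symmDiff_self]; exact J.bot_mem
      symm := fun {a b} h => by rw [symmDiff_comm]; exact h
      trans := fun {a b c} h₁ h₂ => J.symmDiff_trans_mem h₁ h₂ }

/-- The quotient of a Boolean algebra by an ideal. -/
def BoolQuot : Type _ := Quotient (idealSetoid J)

namespace BoolQuot

variable {J}

/-- The class of an element. -/
def mk (J : Order.Ideal α) (a : α) : BoolQuot J := Quotient.mk (idealSetoid J) a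

theorem mk_eq_mk {a b : α} : mk J a = mk J b ↔ symmDiff a b ∈ J :=
  ⟨fun h => Quotient.exact h, fun h => Quotient.sound (s := idealSetoid J) h⟩

theorem sup_congr {a a' b b' : α} (h₁ : symmDiff a a' ∈ J) (h₂ : symmDiff b b' ∈ J) :
    symmDiff (a ⊔ b) (a' ⊔ b') ∈ J := by
  refine J.lower ?_ (Order.Ideal.sup_mem h₁ h₂)
  simp only [symmDiff_def, sup_sdiff]
  refine sup_le (sup_le ?_ ?_) (sup_le ?_ ?_)
  · exact (sdiff_le_sdiff_left le_sup_left).trans (le_sup_left.trans le_sup_left)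
  · exact (sdiff_le_sdiff_left le_sup_right).trans (le_sup_left.trans le_sup_right)
  · exact (sdiff_le_sdiff_left le_sup_left).trans (le_sup_right.trans le_sup_left)
  · exact (sdiff_le_sdiff_left le_sup_right).trans (le_sup_right.trans le_sup_right)

theorem compl_congr {a a' : α} (h : symmDiff a a' ∈ J) : symmDiff aᶜ a'ᶜ ∈ J := by
  rwa [compl_symmDiff_compl]

theorem inf_congr {a a' b b' : α} (h₁ : symmDiff a a' ∈ J) (h₂ : symmDiff b b' ∈ J) :
    symmDiff (a ⊓ b) (a' ⊓ b') ∈ J := by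
  have := compl_congr (sup_congr (compl_congr h₁) (compl_congr h₂))
  simpa using this

theorem sdiff_congr {a a' b b' : α} (h₁ : symmDiff a a' ∈ J) (h₂ : symmDiff b b' ∈ J)
    (h : a \ b ∈ J) : a' \ b' ∈ J := by
  have h₃ : symmDiff (a' \ b') (a \ b) ∈ J := by
    rw [symmDiff_comm, sdiff_eq, sdiff_eq]
    exact inf_congr h₁ (compl_congr h₂)
  have h₄ := J.symmDiff_trans_mem h₃ (c := ⊥) (by rwa [symmDiff_bot])
  rwa [symmDiff_bot] at h₄

instance : Max (BoolQuot J) :=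
  ⟨Quotient.map₂ (· ⊔ ·) fun _ _ h₁ _ _ h₂ => sup_congr h₁ h₂⟩

instance : Min (BoolQuot J) :=
  ⟨Quotient.map₂ (· ⊓ ·) fun _ _ h₁ _ _ h₂ => inf_congr h₁ h₂⟩

instance : Compl (BoolQuot J) :=
  ⟨Quotient.map (·ᶜ) fun _ _ h => compl_congr h⟩

instance : Bot (BoolQuot J) := ⟨mk J ⊥⟩

instance : Top (BoolQuot J) := ⟨mk J ⊤⟩

/-- `[a] ≤ [b]` if and only if `a \ b` belongs to the ideal. -/
instance : LE (BoolQuot J) :=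
  ⟨Quotient.lift₂ (fun a b => a \ b ∈ J) fun _ _ _ _ h₁ h₂ => propext
    ⟨sdiff_congr h₁ h₂, sdiff_congr ((idealSetoid J).symm h₁) ((idealSetoid J).symm h₂)⟩⟩

theorem mk_le_mk {a b : α} : mk J a ≤ mk J b ↔ a \ b ∈ J := Iff.rfl

theorem mk_le_mk_of_le {a b : α} (h : a ≤ b) : mk J a ≤ mk J b := by
  rw [mk_le_mk, sdiff_eq_bot_iff.2 h]
  exact J.bot_mem

theorem mk_sup (a b : α) : mk J (a ⊔ b) = mk J a ⊔ mk J b := rfl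

theorem mk_inf (a b : α) : mk J (a ⊓ b) = mk J a ⊓ mk J b := rfl

/-- The Boolean algebra structure of the quotient; all operations are computed on
representatives. -/
instance : BooleanAlgebra (BoolQuot J) where
  le_refl := by rintro ⟨a⟩; exact mk_le_mk_of_le le_rfl
  le_trans := by
    rintro ⟨a⟩ ⟨b⟩ ⟨c⟩ (h₁ : a \ b ∈ J) (h₂ : b \ c ∈ J)
    exact J.lower (sdiff_triangle a b c) (Order.Ideal.sup_mem h₁ h₂)
  le_antisymm := by
    rintro ⟨a⟩ ⟨b⟩ (h₁ : a \ b ∈ J) (h₂ : b \ a ∈ J)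
    exact mk_eq_mk.2 (Order.Ideal.sup_mem h₁ h₂)
  sup := (· ⊔ ·)
  inf := (· ⊓ ·)
  le_sup_left := by rintro ⟨a⟩ ⟨b⟩; exact mk_le_mk_of_le le_sup_left
  le_sup_right := by rintro ⟨a⟩ ⟨b⟩; exact mk_le_mk_of_le le_sup_right
  sup_le := by
    rintro ⟨a⟩ ⟨b⟩ ⟨c⟩ (h₁ : a \ c ∈ J) (h₂ : b \ c ∈ J)
    show (a ⊔ b) \ c ∈ J
    rw [sup_sdiff]
    exact Order.Ideal.sup_mem h₁ h₂
  inf_le_left := by rintro ⟨a⟩ ⟨b⟩; exact mk_le_mk_of_le inf_le_left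
  inf_le_right := by rintro ⟨a⟩ ⟨b⟩; exact mk_le_mk_of_le inf_le_right
  le_inf := by
    rintro ⟨a⟩ ⟨b⟩ ⟨c⟩ (h₁ : a \ b ∈ J) (h₂ : a \ c ∈ J)
    show a \ (b ⊓ c) ∈ J
    rw [sdiff_inf]
    exact Order.Ideal.sup_mem h₁ h₂
  le_sup_inf := by rintro ⟨a⟩ ⟨b⟩ ⟨c⟩; exact mk_le_mk_of_le le_sup_inf
  le_top := by rintro ⟨a⟩; exact mk_le_mk_of_le le_top
  bot_le := by rintro ⟨a⟩; exact mk_le_mk_of_le bot_le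
  inf_compl_le_bot := by rintro ⟨a⟩; exact mk_le_mk_of_le (inf_compl_eq_bot (a := a)).le
  top_le_sup_compl := by rintro ⟨a⟩; exact mk_le_mk_of_le (sup_compl_eq_top (x := a)).ge

/-- The natural homomorphism from a Boolean algebra onto its quotient by an ideal. -/
def mkHom (J : Order.Ideal α) : BoundedLatticeHom α (BoolQuot J) where
  toFun := mk J
  map_sup' _ _ := rfl
  map_inf' _ _ := rfl
  map_top' := rfl
  map_bot' := rfl

end BoolQuot

end IdealQuotient

section SetAlgebras

variable {M : Type*}

/-- An ideal of the power set of `M` is a `σ`-ideal if it is closed under countable unions. -/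
def IsSigmaIdeal (I : Order.Ideal (Set M)) : Prop :=
  ∀ s : ℕ → Set M, (∀ n, s n ∈ I) → (⋃ n, s n) ∈ I

/-- The `σ`-algebra `𝔄`, as the type of its members; it is a Boolean algebra under the
set-theoretic operations. -/
abbrev SigmaAlg (𝔄 : MeasurableSpace M) : Type _ :=
  Subtype (MeasurableSet[𝔄] : Set M → Prop)

/-- The ideal `I` of the power set, restricted to the members of the `σ`-algebra `𝔄`. -/
def restrictIdeal (I : Order.Ideal (Set M)) (𝔄 : MeasurableSpace M) :
    Order.Ideal (SigmaAlg 𝔄) where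
  carrier := {s | (s : Set M) ∈ I}
  lower' := fun _ _ h hs => I.lower h hs
  nonempty' := ⟨⊥, I.bot_mem⟩
  directed' := fun s hs t ht =>
    ⟨s ⊔ t, Order.Ideal.sup_mem hs ht, le_sup_left (a := s), le_sup_right (a := s)⟩

/-- The quotient Boolean algebra `𝔄/I`. -/
abbrev SigmaQuot (𝔄 : MeasurableSpace M) (I : Order.Ideal (Set M)) : Type _ :=
  BoolQuot (restrictIdeal I 𝔄)

/-- The natural homomorphism `𝔄 → 𝔄/I` can be lifted: it has a right inverse that is a
homomorphism of Boolean algebras. -/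
def HasLifting (𝔄 : MeasurableSpace M) (I : Order.Ideal (Set M)) : Prop :=
  ∃ g : BoundedLatticeHom (SigmaQuot 𝔄 I) (SigmaAlg 𝔄),
    (BoolQuot.mkHom (restrictIdeal I 𝔄)).comp g = BoundedLatticeHom.id (SigmaQuot 𝔄 I)

end SetAlgebras

/-! ### Upper projections onto a complete subalgebra -/

section UpperProjection

variable {B : Type*} [CompleteBooleanAlgebra B]

/-! Take a σ-independent family of sets `A i ⊆ M`, one for each `x i`. Let the ideal be generated by
the σ-terms that vanish at `x`, evaluated at `A`, and let the algebra consist of the sets equal to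
some term value modulo this ideal. Independence gives `c.eval A ∈ I ↔ c.eval x = ⊥`
(`eval_mem_nullIdeal_iff`), so the quotient is a copy of the σ-subalgebra generated by the `x i`,
and it inherits properness and the ccc.

A lifting would choose sets `X i` with `symmDiff (X i) (A i)` inside a null term value `(N i).eval
A`. Apply the disjointness hypothesis to `{i} ∪ support (N i)`, obtaining `F` and `u`. Since the `x
i` with `i ∈ F` have meet `⊥`, the `X i` must have empty intersection. Yet
`exists_mem_and_notMem_eval` finds a point in every `A i \ (N i).eval A`, hence in every `X i`. No
single filter can contain all these `x i`. Instead, each gets its own filter `H i`, all extending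
one filter on the subalgebra generated by `u`, which is possible because each `x i` projects to `⊤`
there. The filters agree on `u`, the remaining variables are disjoint, and independence realizes the
amalgamated pattern by a point. -/

theorem isCompleteSubalgebra_completeClosure (X : Set B) :
    IsCompleteSubalgebra (completeClosure X) := by
  intro T hT
  refine BooleanSubalgebra.mem_sInf.2 fun C hC => hC.1 T fun b hb => ?_
  exact BooleanSubalgebra.mem_sInf.1 (hT hb) C hC

theorem subset_completeClosure (X : Set B) : X ⊆ (completeClosure X : Set B) := fun _ hb =>
  BooleanSubalgebra.mem_sInf.2 fun _ hC => hC.2 hb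

theorem IsCompleteSubalgebra.sInf_mem {C : BooleanSubalgebra B} (hC : IsCompleteSubalgebra C)
    {T : Set B} (hT : T ⊆ (C : Set B)) : sInf T ∈ C := by
  have h : sSup (compl '' T) ∈ C := hC _ (by
    rintro _ ⟨b, hb, rfl⟩
    exact BooleanSubalgebra.compl_mem (hT hb))
  have h' := BooleanSubalgebra.compl_mem h
  rwa [sSup_image, ← compl_sInf, compl_compl] at h'

/-- The least element of `C` above `b`, when `C` is a complete subalgebra. -/
def upperProj (C : BooleanSubalgebra B) (b : B) : B := sInf {c | c ∈ C ∧ b ≤ c}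

variable {C : BooleanSubalgebra B}

theorem le_upperProj (b : B) : b ≤ upperProj C b := le_sInf fun _ h => h.2

theorem upperProj_le {b c : B} (hc : c ∈ C) (h : b ≤ c) : upperProj C b ≤ c := sInf_le ⟨hc, h⟩

theorem upperProj_of_mem {b : B} (hb : b ∈ C) : upperProj C b = b :=
  (upperProj_le hb le_rfl).antisymm (le_upperProj b)

theorem upperProj_mono {b c : B} (h : b ≤ c) : upperProj C b ≤ upperProj C c :=
  sInf_le_sInf fun _ hd => ⟨hd.1, h.trans hd.2⟩

theorem upperProj_mem (hC : IsCompleteSubalgebra C) (b : B) : upperProj C b ∈ C :=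
  hC.sInf_mem fun _ h => h.1

theorem upperProj_iSup (hC : IsCompleteSubalgebra C) {ι : Sort*} (f : ι → B) :
    upperProj C (⨆ n, f n) = ⨆ n, upperProj C (f n) := by
  refine le_antisymm (upperProj_le (hC _ ?_) (iSup_mono fun n => le_upperProj _))
    (iSup_le fun n => upperProj_mono (le_iSup f n))
  rintro _ ⟨n, rfl⟩
  exact upperProj_mem hC _

end UpperProjection

/-! ### Filters deciding countably many suprema -/

section GenericFilter

variable {B : Type*} [CompleteBooleanAlgebra B]

/-- The filter `G` contains, for each sequence in `𝒜`, one of its terms or the complement of its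
supremum. -/
def Decides (G : Order.PFilter B) (𝒜 : Set (ℕ → B)) : Prop :=
  ∀ a ∈ 𝒜, (⨆ n, a n)ᶜ ∈ G ∨ ∃ n, a n ∈ G

theorem Decides.mono {G : Order.PFilter B} {𝒜 ℬ : Set (ℕ → B)} (h : Decides G ℬ) (hs : 𝒜 ⊆ ℬ) :
    Decides G 𝒜 := fun a ha => h a (hs ha)

/-- A form of the Rasiowa–Sikorski lemma: `P` is a notion of positivity, and the construction of
the filter stays in the set `D`. -/
theorem exists_decides_of_step {P : B → Prop} {D : Set B} (hmono : ∀ a b, a ≤ b → P a → P b)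
    {d₀ : B} (hd₀ : d₀ ∈ D) (hP : P d₀) {𝒜 : Set (ℕ → B)} (h𝒜 : 𝒜.Countable)
    (hstep : ∀ a ∈ 𝒜, ∀ d ∈ D, P d →
      (d \ (⨆ n, a n) ∈ D ∧ P (d \ (⨆ n, a n))) ∨ ∃ n, d ⊓ a n ∈ D ∧ P (d ⊓ a n)) :
    ∃ G : Order.PFilter B, d₀ ∈ G ∧ (∀ g ∈ G, P g) ∧ Decides G 𝒜 := by
  have : Encodable 𝒜 := h𝒜.toEncodable
  -- Stage `k` treats the only sequence with code `k`, and does nothing if there is none.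
  have key : ∀ (k : ℕ) (d : {d // d ∈ D ∧ P d}), ∃ d' : {d // d ∈ D ∧ P d}, d' ≤ d ∧
      ∀ a : 𝒜, Encodable.encode a = k →
        d'.1 ≤ (⨆ n, a.1 n)ᶜ ∨ ∃ n, d'.1 ≤ a.1 n := by
    intro k d
    by_cases hk : ∃ a : 𝒜, Encodable.encode a = k
    · obtain ⟨a, rfl⟩ := hk
      rcases hstep a a.2 d d.2.1 d.2.2 with h | ⟨n, h⟩
      · refine ⟨⟨_, h⟩, sdiff_le, fun b hb => ?_⟩
        obtain rfl := Encodable.encode_injective hb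
        exact .inl (by simp only [sdiff_eq]; exact inf_le_right)
      · refine ⟨⟨_, h⟩, inf_le_left (a := d.1), fun b hb => ?_⟩
        obtain rfl := Encodable.encode_injective hb
        exact .inr ⟨n, inf_le_right⟩
    · exact ⟨d, le_rfl, fun a ha => (hk ⟨a, ha⟩).elim⟩
  choose f hf using key
  let e : ℕ → {d // d ∈ D ∧ P d} := fun k => Nat.rec ⟨d₀, hd₀, hP⟩ (fun k d => f k d) k
  have he : Antitone e := antitone_nat_of_succ_le fun k => (hf k (e k)).1
  have hG : Order.IsPFilter {b : B | ∃ k, (e k).1 ≤ b} := by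
    refine Order.IsPFilter.of_def ⟨d₀, 0, le_rfl⟩ ?_ ?_
    · rintro a ⟨k, hk⟩ b ⟨l, hl⟩
      refine ⟨(e (max k l)).1, ⟨_, le_rfl⟩, ?_, ?_⟩
      · exact le_trans (he (le_max_left k l)) hk
      · exact le_trans (he (le_max_right k l)) hl
    · rintro a b hab ⟨k, hk⟩
      exact ⟨k, hk.trans hab⟩
  have hmem : ∀ b, b ∈ hG.toPFilter ↔ ∃ k, (e k).1 ≤ b := fun b => Iff.rfl
  refine ⟨hG.toPFilter, (hmem _).2 ⟨0, le_rfl⟩, ?_, ?_⟩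
  · rintro g ⟨k, hk⟩
    exact hmono _ _ hk (e k).2.2
  · intro a ha
    rcases (hf (Encodable.encode (⟨a, ha⟩ : 𝒜)) (e _)).2 ⟨a, ha⟩ rfl with h | ⟨n, h⟩
    · exact .inl ((hmem _).2 ⟨_ + 1, h⟩)
    · exact .inr ⟨n, (hmem _).2 ⟨_ + 1, h⟩⟩

theorem sdiff_iSup_sup_iSup_inf (d : B) (a : ℕ → B) :
    d \ (⨆ n, a n) ⊔ ⨆ n, d ⊓ a n = d := by
  rw [← inf_iSup_eq, sup_comm, sup_inf_sdiff]

/-- The Rasiowa–Sikorski lemma. -/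
theorem exists_decides {d₀ : B} (hd₀ : d₀ ≠ ⊥) {𝒜 : Set (ℕ → B)} (h𝒜 : 𝒜.Countable) :
    ∃ G : Order.PFilter B, d₀ ∈ G ∧ ⊥ ∉ G ∧ Decides G 𝒜 := by
  obtain ⟨G, h₁, h₂, h₃⟩ := exists_decides_of_step (P := (· ≠ ⊥)) (D := Set.univ)
    (fun a b h ha => ne_bot_of_le_ne_bot ha h) (Set.mem_univ d₀) hd₀ h𝒜 (by
      intro a _ d _ hd
      simp only [Set.mem_univ, true_and]
      by_contra! h
      apply hd
      rw [← sdiff_iSup_sup_iSup_inf d a, h.1]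
      simp [h.2])
  exact ⟨G, h₁, fun h => h₂ _ h rfl, h₃⟩

/-- The elements obtained from `d₀` by finitely many steps, each of which subtracts the supremum
of a sequence of `𝒜` or intersects with a term of such a sequence. -/
def decisionSet (𝒜 : Set (ℕ → B)) (d₀ : B) : Set B :=
  Set.range fun l : List (𝒜 × Option ℕ) =>
    l.foldr (fun p d => p.2.elim (d \ ⨆ n, p.1.1 n) fun n => d ⊓ p.1.1 n) d₀

/-- The filter on the subalgebra is built before the extension, so it must anticipate every stage
the extension may reach. Countability keeps these requirements within Rasiowa–Sikorski. -/
theorem countable_decisionSet {𝒜 : Set (ℕ → B)} (h𝒜 : 𝒜.Countable) (d₀ : B) :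
    (decisionSet 𝒜 d₀).Countable := by
  have := h𝒜.to_subtype
  exact Set.countable_range _

theorem self_mem_decisionSet (𝒜 : Set (ℕ → B)) (d₀ : B) : d₀ ∈ decisionSet 𝒜 d₀ := ⟨[], rfl⟩

theorem sdiff_mem_decisionSet {𝒜 : Set (ℕ → B)} {d₀ d : B} (hd : d ∈ decisionSet 𝒜 d₀)
    {a : ℕ → B} (ha : a ∈ 𝒜) : d \ (⨆ n, a n) ∈ decisionSet 𝒜 d₀ := by
  obtain ⟨l, rfl⟩ := hd
  exact ⟨(⟨a, ha⟩, none) :: l, rfl⟩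

theorem inf_mem_decisionSet {𝒜 : Set (ℕ → B)} {d₀ d : B} (hd : d ∈ decisionSet 𝒜 d₀)
    {a : ℕ → B} (ha : a ∈ 𝒜) (n : ℕ) : d ⊓ a n ∈ decisionSet 𝒜 d₀ := by
  obtain ⟨l, rfl⟩ := hd
  exact ⟨(⟨a, ha⟩, some n) :: l, rfl⟩

/-- The projection to `C` of the partition of `d` into `d \ ⨆ n, a n` and the `d ⊓ a n`. -/
def projSeq (C : BooleanSubalgebra B) (d : B) (a : ℕ → B) : ℕ → B
  | 0 => upperProj C (d \ ⨆ n, a n)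
  | n + 1 => upperProj C (d ⊓ a n)

theorem iSup_projSeq {C : BooleanSubalgebra B} (hC : IsCompleteSubalgebra C) (d : B)
    (a : ℕ → B) : ⨆ n, projSeq C d a n = upperProj C d := by
  have h : ∀ n, projSeq C d a n =
      upperProj C ((fun n => Nat.casesOn n (d \ ⨆ n, a n) fun n => d ⊓ a n : ℕ → B) n) := by
    rintro (_ | n) <;> rfl
  rw [iSup_congr h, ← upperProj_iSup hC, ← sup_iSup_nat_succ]
  exact congrArg _ (sdiff_iSup_sup_iSup_inf d a)

/-- The sequences which a filter has to decide so that it extends, over the complete subalgebra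
`C`, to a filter that contains `d₀` and decides `𝒜`. -/
def projFamily (C : BooleanSubalgebra B) (𝒜 : Set (ℕ → B)) (d₀ : B) : Set (ℕ → B) :=
  Set.image2 (projSeq C) (decisionSet 𝒜 d₀) 𝒜

theorem countable_projFamily (C : BooleanSubalgebra B) {𝒜 : Set (ℕ → B)} (h𝒜 : 𝒜.Countable)
    (d₀ : B) : (projFamily C 𝒜 d₀).Countable :=
  (countable_decisionSet h𝒜 d₀).image2 h𝒜 _

theorem compl_notMem_of_bot_notMem {G : Order.PFilter B} (hG : ⊥ ∉ G) {b : B} (hb : b ∈ G) :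
    bᶜ ∉ G := fun h => hG (inf_compl_self b ▸ Order.PFilter.inf_mem hb h)

/-- Positivity of `d` now means that its projection lies in `G`. The pieces of `d` have projections
with supremum `upperProj C d ∈ G`, so `G`, deciding that sequence, contains the projection of one
piece. -/
theorem exists_decides_extension {C : BooleanSubalgebra B} (hC : IsCompleteSubalgebra C)
    {𝒜 : Set (ℕ → B)} (h𝒜 : 𝒜.Countable) {d₀ : B} {G : Order.PFilter B} (hG : ⊥ ∉ G)
    (hd₀ : upperProj C d₀ ∈ G) (hdec : Decides G (projFamily C 𝒜 d₀)) :
    ∃ H : Order.PFilter B, d₀ ∈ H ∧ (∀ b ∈ H, upperProj C b ∈ G) ∧ Decides H 𝒜 := by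
  refine exists_decides_of_step (P := fun d => upperProj C d ∈ G)
    (fun a b h ha => Order.PFilter.mem_of_le (upperProj_mono h) ha)
    (self_mem_decisionSet 𝒜 d₀) hd₀ h𝒜 fun a ha d hd hdG => ?_
  rcases hdec _ ⟨d, hd, a, ha, rfl⟩ with h | ⟨_ | n, h⟩
  · rw [iSup_projSeq hC] at h
    exact (compl_notMem_of_bot_notMem hG hdG h).elim
  · exact .inl ⟨sdiff_mem_decisionSet hd ha, h⟩
  · exact .inr ⟨n, inf_mem_decisionSet hd ha n, h⟩

end GenericFilter

/-! ### σ-terms and their evaluation -/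

/-- Terms in the language of `σ`-complete Boolean algebras with variables in `Λ`. -/
inductive SigmaTerm (Λ : Type v) : Type v
  | var (i : Λ) : SigmaTerm Λ
  | compl (c : SigmaTerm Λ) : SigmaTerm Λ
  | iSup (f : ℕ → SigmaTerm Λ) : SigmaTerm Λ

namespace SigmaTerm

variable {Λ : Type v} {B : Type*} [CompleteBooleanAlgebra B]

/-- The value of a term at an assignment of its variables. -/
def eval (x : Λ → B) : SigmaTerm Λ → B
  | var i => x i
  | compl c => (eval x c)ᶜ
  | iSup f => ⨆ n, eval x (f n)

/-- The variables of a term. -/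
def support : SigmaTerm Λ → Set Λ
  | var i => {i}
  | compl c => support c
  | iSup f => ⋃ n, support (f n)

theorem countable_support (c : SigmaTerm Λ) : c.support.Countable := by
  induction c with
  | var i => exact Set.countable_singleton i
  | compl c ih => exact ih
  | iSup f ih => exact Set.countable_iUnion ih

/-- The sequences that have to be decided by a filter so that it determines the value of a
term. -/
def families (x : Λ → B) : SigmaTerm Λ → Set (ℕ → B)
  -- Deciding a constant sequence means containing its value or the complement of that value.
  | var i => {fun _ => x i}
  | compl c => families x c
  | iSup f => insert (fun n => eval x (f n)) (⋃ n, families x (f n))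

theorem countable_families (x : Λ → B) (c : SigmaTerm Λ) : (c.families x).Countable := by
  induction c with
  | var i => exact Set.countable_singleton _
  | compl c ih => exact ih
  | iSup f ih => exact (Set.countable_iUnion ih).insert _

theorem eval_mem_or_compl_mem {x : Λ → B} {G : Order.PFilter B} {c : SigmaTerm Λ}
    (h : Decides G (c.families x)) : c.eval x ∈ G ∨ (c.eval x)ᶜ ∈ G := by
  induction c with
  | var i =>
    rcases h _ rfl with h | ⟨_, h⟩
    · exact .inr (by simpa [eval] using h)
    · exact .inl h
  | compl c ih => simpa [eval, or_comm] using ih h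
  | iSup f ih =>
    rcases h _ (.inl rfl) with h | ⟨n, h⟩
    · exact .inr h
    · exact .inl (Order.PFilter.mem_of_le (le_iSup (fun n => eval x (f n)) n) h)

/-- The truth lemma: on the subterms of `c`, a deciding filter commutes with complements and
countable suprema, just as membership of a point does. -/
theorem mem_eval_iff {M : Type*} {A : Λ → Set M} {x : Λ → B} {G : Order.PFilter B} (hG : ⊥ ∉ G)
    {m : M} {c : SigmaTerm Λ} (h : Decides G (c.families x))
    (hm : ∀ j ∈ c.support, m ∈ A j ↔ x j ∈ G) : m ∈ c.eval A ↔ c.eval x ∈ G := by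
  induction c with
  | var i => exact hm i rfl
  | compl c ih =>
    show m ∉ eval A c ↔ (eval x c)ᶜ ∈ G
    rw [ih h hm]
    exact ⟨(eval_mem_or_compl_mem (c := c) h).resolve_left, fun h h' => compl_notMem_of_bot_notMem hG h' h⟩
  | iSup f ih =>
    have hf : ∀ n, m ∈ eval A (f n) ↔ eval x (f n) ∈ G := fun n =>
      ih n (h.mono fun a ha => .inr (Set.mem_iUnion.2 ⟨n, ha⟩))
        fun j hj => hm j (Set.mem_iUnion.2 ⟨n, hj⟩)
    show m ∈ ⋃ n, eval A (f n) ↔ (⨆ n, eval x (f n)) ∈ G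
    rw [Set.mem_iUnion]
    simp only [hf]
    refine ⟨fun ⟨n, hn⟩ => Order.PFilter.mem_of_le (le_iSup (fun n => eval x (f n)) n) hn,
      fun hs => ?_⟩
    exact (h _ (.inl rfl)).resolve_left (compl_notMem_of_bot_notMem hG hs)

/-- The term for a binary supremum. -/
def sup (c d : SigmaTerm Λ) : SigmaTerm Λ := iSup fun n => Nat.casesOn n c fun _ => d

/-- The term for a binary infimum. -/
def inf (c d : SigmaTerm Λ) : SigmaTerm Λ := compl (sup (compl c) (compl d))

theorem eval_compl (x : Λ → B) (c : SigmaTerm Λ) : (compl c).eval x = (c.eval x)ᶜ := rfl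

theorem eval_iSup (x : Λ → B) (f : ℕ → SigmaTerm Λ) :
    (iSup f).eval x = ⨆ n, (f n).eval x := rfl

theorem eval_sup (x : Λ → B) (c d : SigmaTerm Λ) :
    (sup c d).eval x = c.eval x ⊔ d.eval x := by
  rw [sup, eval_iSup, ← sup_iSup_nat_succ]
  exact congrArg _ (ciSup_const (a := d.eval x))

theorem eval_inf (x : Λ → B) (c d : SigmaTerm Λ) :
    (inf c d).eval x = c.eval x ⊓ d.eval x := by
  simp [inf, eval_compl, eval_sup]

end SigmaTerm

/-- Every choice of membership or non-membership in countably many of the sets `A j` is realized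
by a point. -/
def SigmaIndependent {Λ M : Type*} (A : Λ → Set M) : Prop :=
  ∀ v : Set Λ, v.Countable → ∀ t : Set Λ, ∃ m, ∀ j ∈ v, m ∈ A j ↔ j ∈ t

/-! ### The ideal, the σ-algebra and the chain condition -/

section NullIdeal

variable {Λ : Type v} {M : Type*} {B : Type*} [CompleteBooleanAlgebra B]

/-- If the value at `x` were nonzero, a filter containing it and deciding `c` would prescribe a
membership pattern on the support; a point realizing it would lie in `c.eval A`. -/
theorem SigmaIndependent.eval_eq_bot {A : Λ → Set M} (hA : SigmaIndependent A) {x : Λ → B}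
    {c : SigmaTerm Λ} (h : c.eval A = ∅) : c.eval x = ⊥ := by
  by_contra hc
  obtain ⟨G, hcG, hG, hdec⟩ := exists_decides hc (c.countable_families x)
  obtain ⟨m, hm⟩ := hA c.support c.countable_support {j | x j ∈ G}
  have := (SigmaTerm.mem_eval_iff hG hdec hm).2 hcG
  rw [h] at this
  exact this

/-- The subsets of the sets `c.eval A`, where `c` is a term with value `⊥` at `x`. -/
def nullIdeal [Nonempty Λ] (A : Λ → Set M) (x : Λ → B) : Order.Ideal (Set M) where
  carrier := {s | ∃ c : SigmaTerm Λ, s ⊆ c.eval A ∧ c.eval x = ⊥}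
  lower' := fun _ _ h ⟨c, hc, hx⟩ => ⟨c, h.trans hc, hx⟩
  nonempty' := by
    obtain ⟨i⟩ := ‹Nonempty Λ›
    refine ⟨∅, .inf (.var i) (.compl (.var i)), Set.empty_subset _, ?_⟩
    simp [SigmaTerm.eval_inf, SigmaTerm.eval_compl]
  directed' := by
    rintro s ⟨c, hc, hcx⟩ t ⟨d, hd, hdx⟩
    refine ⟨s ∪ t, ⟨c.sup d, ?_, by simp [SigmaTerm.eval_sup, hcx, hdx]⟩,
      Set.subset_union_left, Set.subset_union_right⟩
    rw [SigmaTerm.eval_sup]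
    exact Set.union_subset_union hc hd

variable [Nonempty Λ] {A : Λ → Set M} {x : Λ → B}

theorem isSigmaIdeal_nullIdeal : IsSigmaIdeal (nullIdeal A x) := by
  intro s hs
  choose c hc hx using hs
  refine ⟨.iSup c, Set.iUnion_subset fun n => ?_, ?_⟩
  · exact (hc n).trans (Set.subset_iUnion (fun n => (c n).eval A) n)
  · simp [SigmaTerm.eval_iSup, hx]

theorem SigmaIndependent.eval_mem_nullIdeal_iff (hA : SigmaIndependent A) {c : SigmaTerm Λ} :
    c.eval A ∈ nullIdeal A x ↔ c.eval x = ⊥ := by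
  refine ⟨fun ⟨d, hcd, hd⟩ => ?_, fun h => ⟨c, subset_rfl, h⟩⟩
  have h : (c.inf d.compl).eval A = ∅ := by
    rw [SigmaTerm.eval_inf, SigmaTerm.eval_compl]
    exact Set.sdiff_eq_empty.2 hcd
  simpa [SigmaTerm.eval_inf, SigmaTerm.eval_compl, hd] using hA.eval_eq_bot (x := x) h

theorem SigmaIndependent.univ_notMem_nullIdeal [Nontrivial B] (hA : SigmaIndependent A) :
    Set.univ ∉ nullIdeal A x := by
  obtain ⟨i⟩ := ‹Nonempty Λ›
  intro h
  let c : SigmaTerm Λ := .sup (.var i) (.compl (.var i))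
  have h' : c.eval A ∈ nullIdeal A x := (nullIdeal A x).lower (Set.subset_univ _) h
  rw [hA.eval_mem_nullIdeal_iff] at h'
  simp [c, SigmaTerm.eval_sup, SigmaTerm.eval_compl] at h'

/-- The sets which agree modulo `nullIdeal A x` with the value of a term at `A`. -/
@[reducible] def termAlgebra (A : Λ → Set M) (x : Λ → B) : MeasurableSpace M where
  MeasurableSet' s := ∃ c : SigmaTerm Λ, symmDiff s (c.eval A) ∈ nullIdeal A x
  measurableSet_empty := by
    obtain ⟨i⟩ := ‹Nonempty Λ›
    refine ⟨.inf (.var i) (.compl (.var i)), ?_⟩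
    simpa [SigmaTerm.eval_inf, SigmaTerm.eval_compl] using (nullIdeal A x).bot_mem
  measurableSet_compl := by
    rintro s ⟨c, hc⟩
    refine ⟨c.compl, ?_⟩
    rw [SigmaTerm.eval_compl]
    exact BoolQuot.compl_congr hc
  measurableSet_iUnion := by
    intro s hs
    choose c hc using hs
    refine ⟨.iSup c, (nullIdeal A x).lower ?_ (isSigmaIdeal_nullIdeal _ hc)⟩
    intro m hm
    rw [SigmaTerm.eval_iSup, Set.iSup_eq_iUnion, Set.mem_symmDiff] at hm
    simp only [Set.mem_iUnion] at hm ⊢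
    rcases hm with ⟨⟨n, hn⟩, h⟩ | ⟨⟨n, hn⟩, h⟩
    · exact ⟨n, .inl ⟨hn, fun h' => h ⟨n, h'⟩⟩⟩
    · exact ⟨n, .inr ⟨hn, fun h' => h ⟨n, h'⟩⟩⟩

theorem measurableSet_termAlgebra_eval (c : SigmaTerm Λ) :
    MeasurableSet[termAlgebra A x] (c.eval A) :=
  ⟨c, by rw [symmDiff_self]; exact (nullIdeal A x).bot_mem⟩

theorem measurableSet_termAlgebra_of_mem {s : Set M} (hs : s ∈ nullIdeal A x) :
    MeasurableSet[termAlgebra A x] s := by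
  obtain ⟨c, hc⟩ := (termAlgebra A x).measurableSet_empty
  refine ⟨c, (nullIdeal A x).symmDiff_trans_mem ?_ hc⟩
  rwa [← Set.bot_eq_empty, symmDiff_bot]

/-- The class of the value of a term. -/
noncomputable def termClass (A : Λ → Set M) (x : Λ → B) (c : SigmaTerm Λ) :
    SigmaQuot (termAlgebra A x) (nullIdeal A x) :=
  BoolQuot.mk _ ⟨c.eval A, measurableSet_termAlgebra_eval c⟩

theorem termClass_surjective : Function.Surjective (termClass A x) := by
  rintro ⟨s, c, hc⟩
  refine ⟨c, BoolQuot.mk_eq_mk.2 ?_⟩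
  rw [symmDiff_comm]
  exact hc

theorem SigmaIndependent.termClass_eq_bot_iff (hA : SigmaIndependent A) {c : SigmaTerm Λ} :
    termClass A x c = ⊥ ↔ c.eval x = ⊥ := by
  rw [← hA.eval_mem_nullIdeal_iff (A := A)]
  refine BoolQuot.mk_eq_mk.trans ?_
  rw [symmDiff_bot]
  rfl

theorem termClass_inf (c d : SigmaTerm Λ) :
    termClass A x (c.inf d) = termClass A x c ⊓ termClass A x d := by
  refine congrArg (BoolQuot.mk _) (Subtype.ext ?_)
  exact SigmaTerm.eval_inf A c d

theorem exists_termClass_eq_finset_inf (A : Λ → Set M) (x : Λ → B) (F : Finset Λ) :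
    ∃ c : SigmaTerm Λ, c.eval x = F.inf x ∧
      termClass A x c = F.inf fun i => termClass A x (.var i) := by
  classical
  induction F using Finset.induction_on with
  | empty =>
    obtain ⟨i⟩ := ‹Nonempty Λ›
    refine ⟨.sup (.var i) (.compl (.var i)), ?_, ?_⟩
    · simp [SigmaTerm.eval_sup, SigmaTerm.eval_compl]
    · refine congrArg (BoolQuot.mk _) (Subtype.ext ?_)
      exact (SigmaTerm.eval_sup A _ _).trans sup_compl_eq_top
  | insert i F _ ih =>
    obtain ⟨c, h₁, h₂⟩ := ih
    refine ⟨.inf (.var i) c, ?_, ?_⟩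
    · rw [SigmaTerm.eval_inf, h₁, Finset.inf_insert]
      rfl
    · rw [termClass_inf, h₂, Finset.inf_insert]
      rfl

/-- Choosing a term for each class carries an antichain injectively to an antichain of `B`, since
meets and vanishing are read off at `x`. -/
theorem SigmaIndependent.boolCCC (hA : SigmaIndependent A) (hB : BoolCCC B) :
    BoolCCC (SigmaQuot (termAlgebra A x) (nullIdeal A x)) := by
  intro S hS hdisj
  choose c hc using termClass_surjective (A := A) (x := x)
  have hbot : ∀ q, q ≠ ⊥ → (c q).eval x ≠ ⊥ := fun q hq h =>
    hq (hc q ▸ hA.termClass_eq_bot_iff.2 h)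
  have hd : ∀ q ∈ S, ∀ r ∈ S, q ≠ r → Disjoint ((c q).eval x) ((c r).eval x) := by
    intro q hq r hr hqr
    have h : q ⊓ r = ⊥ := disjoint_iff.1 (hdisj hq hr hqr)
    rw [← hc q, ← hc r, ← termClass_inf, hA.termClass_eq_bot_iff, SigmaTerm.eval_inf] at h
    exact disjoint_iff.2 h
  have hne : ∀ q ∈ S, q ≠ ⊥ := fun q hq h => hS (h ▸ hq)
  have hinj : Set.InjOn (fun q => (c q).eval x) S := by
    intro q hq r hr h
    by_contra hqr
    have := hd q hq r hr hqr
    rw [show (c q).eval x = (c r).eval x from h, disjoint_self] at this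
    exact hbot r (hne r hr) this
  refine (Set.countable_of_injective_of_countable_image hinj) (hB _ ?_ ?_)
  · rintro ⟨q, hq, h⟩
    exact hbot q (hne q hq) h
  · rintro _ ⟨q, hq, rfl⟩ _ ⟨r, hr, rfl⟩ h
    exact hd q hq r hr fun e => h (by rw [e])

end NullIdeal

/-! ### Existence of a σ-independent family -/

/-- The Engelking–Karłowicz theorem for countable subfamilies. -/
theorem exists_sigmaIndependent {M : Type u} {Λ : Type v} (hM : ℵ₀ ≤ #M) (hMω : #M ^ ℵ₀ = #M)
    (hΛM : Cardinal.lift.{u} #Λ ≤ Cardinal.lift.{v} (2 ^ #M)) :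
    ∃ A : Λ → Set M, SigmaIndependent A := by
  obtain ⟨ι⟩ : Nonempty (Λ ↪ Set M) := by
    rw [← Cardinal.lift_mk_le', Cardinal.mk_set]
    exact hΛM
  have hcard : #M = #((ℕ → M) × Set (ℕ × ℕ)) := by
    have h1 : #(ℕ → M) = #M := by simp [hMω]
    have h2 : (2 : Cardinal.{u}) ^ ℵ₀ ≤ #M := by
      calc (2 : Cardinal.{u}) ^ ℵ₀ ≤ #M ^ ℵ₀ :=
            Cardinal.power_le_power_right ((Cardinal.natCast_le_aleph0 (n := 2)).trans hM)
        _ = #M := hMω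
    have h3 : Cardinal.lift.{u} #(Set (ℕ × ℕ)) ≤ #M := by
      simpa [Cardinal.mk_set] using h2
    rw [Cardinal.mk_prod, h1, Cardinal.lift_uzero]
    exact (Cardinal.mul_eq_left hM h3 (by simp [Cardinal.mk_set, Cardinal.continuum_ne_zero])).symm
  obtain ⟨e⟩ := Cardinal.eq.1 hcard
  -- A point codes a sequence in `M` and a table of rows. It belongs to the set of `j` when some
  -- active row is the trace of `ι j` on the sequence. Column `0` marks active rows, so that an
  -- unused row is not mistaken for an empty trace.
  refine ⟨fun j => {m | ∃ n, (n, 0) ∈ (e m).2 ∧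
    ∀ k, (n, k + 1) ∈ (e m).2 ↔ (e m).1 k ∈ ι j}, fun v hv t => ?_⟩
  obtain ⟨f, hf⟩ := Set.countable_iff_exists_injOn.1 hv
  have hsep : ∀ a b : Λ, ∃ m, (m ∈ ι a ↔ m ∈ ι b) → a = b := by
    intro a b
    by_contra! h
    obtain ⟨m⟩ : Nonempty M := Cardinal.mk_ne_zero_iff.1 (Cardinal.aleph0_pos.trans_le hM).ne'
    exact (h m).2 (ι.injective (Set.ext fun m => (h m).1))
  choose sep hsep using hsep
  obtain ⟨s, hs⟩ : ∃ s : ℕ → M, Set.image2 sep v v ⊆ Set.range s := by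
    rcases (Set.image2 sep v v).eq_empty_or_nonempty with h | h
    · obtain ⟨m⟩ : Nonempty M := Cardinal.mk_ne_zero_iff.1 (Cardinal.aleph0_pos.trans_le hM).ne'
      exact ⟨fun _ => m, h ▸ Set.empty_subset _⟩
    · obtain ⟨s, hs⟩ := (hv.image2 hv sep).exists_eq_range h
      exact ⟨s, hs.subset⟩
  -- Row `f j` is active exactly for `j ∈ v ∩ t`. As `s` separates the members of `v`, no other
  -- index of `v` has the same trace.
  let R : Set (ℕ × ℕ) := {p | ∃ j ∈ v, j ∈ t ∧ f j = p.1 ∧ ∀ k, p.2 = k + 1 → s k ∈ ι j}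
  have hR₁ : ∀ j ∈ v, j ∈ t → ∀ k, (f j, k + 1) ∈ R ↔ s k ∈ ι j := by
    refine fun j hj hjt k => ⟨?_, fun h => ⟨j, hj, hjt, rfl, ?_⟩⟩
    · rintro ⟨j', hj', -, h, hk⟩
      exact hf hj' hj h ▸ hk k rfl
    · rintro _ ⟨⟩
      exact h
  refine ⟨e.symm (s, R), fun j hj => ?_⟩
  simp only [Set.mem_ofPred_eq, Equiv.apply_symm_apply]
  refine ⟨?_, fun hjt => ⟨f j, ⟨j, hj, hjt, rfl, by simp⟩, hR₁ j hj hjt⟩⟩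
  rintro ⟨n, ⟨j', hj', hjt, rfl, -⟩, h⟩
  obtain ⟨k, hk⟩ := hs (Set.mem_image2_of_mem hj hj')
  have : j = j' := hsep j j' (by rw [← hk, ← h k, hR₁ j' hj' hjt k])
  exact this ▸ hjt

/-! ### Absence of a lifting -/

section NoLifting

variable {Λ : Type v} {M : Type*} {B : Type*} [CompleteBooleanAlgebra B]

theorem SigmaIndependent.exists_mem_and_notMem_eval [Nontrivial B] {A : Λ → Set M}
    (hA : SigmaIndependent A) {x : Λ → B} {C : BooleanSubalgebra B} (hC : IsCompleteSubalgebra C)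
    {u : Set Λ} (hu : u.Countable) (huC : ∀ j ∈ u, x j ∈ C) {F : Finset Λ}
    (hproj : ∀ i ∈ F, upperProj C (x i) = ⊤) {N : Λ → SigmaTerm Λ}
    (hN : ∀ i, (N i).eval x = ⊥)
    (hdisj : (F : Set Λ).PairwiseDisjoint fun i => insert i (N i).support \ u) :
    ∃ m, ∀ i ∈ F, m ∈ A i ∧ m ∉ (N i).eval A := by
  -- The constant sequences make each extension decide every `x j` with `j ∈ u`, which forces
  -- agreement with `G` there.
  let 𝒜 : Λ → Set (ℕ → B) := fun i => (N i).families x ∪ (fun j _ => x j) '' u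
  have h𝒜 : ∀ i, (𝒜 i).Countable := fun i => ((N i).countable_families x).union (hu.image _)
  obtain ⟨G, -, hG, hdec⟩ := exists_decides (top_ne_bot : (⊤ : B) ≠ ⊥)
    (F.countable_toSet.biUnion fun i _ => countable_projFamily C (h𝒜 i) (x i))
  have hext : ∀ i, ∃ H : Order.PFilter B, i ∈ F →
      x i ∈ H ∧ (∀ b ∈ H, upperProj C b ∈ G) ∧ Decides H (𝒜 i) := by
    intro i
    by_cases hi : i ∈ F
    · obtain ⟨H, hH⟩ := exists_decides_extension hC (h𝒜 i) hG
        (d₀ := x i) (by rw [hproj i hi]; exact Order.PFilter.top_mem)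
        (hdec.mono fun a ha => Set.mem_biUnion (Finset.mem_coe.2 hi) ha)
      exact ⟨H, fun _ => hH⟩
    · exact ⟨G, fun h => (hi h).elim⟩
  choose H hH using hext
  have hbot : ∀ i ∈ F, ⊥ ∉ H i := fun i hi h => hG <| by
    simpa [upperProj_of_mem (BooleanSubalgebra.bot_mem (L := C))] using (hH i hi).2.1 _ h
  have hcompat : ∀ i ∈ F, ∀ j ∈ u, x j ∈ H i ↔ x j ∈ G := by
    intro i hi j hj
    have hG' : ∀ b ∈ C, b ∈ H i → b ∈ G := fun b hb h =>
      upperProj_of_mem hb ▸ (hH i hi).2.1 b h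
    refine ⟨hG' _ (huC j hj), fun h => ?_⟩
    rcases (hH i hi).2.2 (fun _ => x j) (.inr ⟨j, hj, rfl⟩) with h' | ⟨_, h'⟩
    · rw [ciSup_const] at h'
      exact (compl_notMem_of_bot_notMem hG h
        (hG' _ (BooleanSubalgebra.compl_mem (huC j hj)) h')).elim
    · exact h'
  -- The amalgam: `G` prescribes the pattern on `u`, and off `u` each index belongs to the set of at
  -- most one `i ∈ F`, whose filter prescribes it.
  let t : Set Λ := {j | (j ∈ u ∧ x j ∈ G) ∨
    ∃ i ∈ F, j ∈ insert i (N i).support \ u ∧ x j ∈ H i}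
  obtain ⟨m, hm⟩ := hA (⋃ i ∈ F, insert i (N i).support)
    (F.countable_toSet.biUnion fun i _ => (N i).countable_support.insert i) t
  have key : ∀ i ∈ F, ∀ j ∈ insert i (N i).support, m ∈ A j ↔ x j ∈ H i := by
    intro i hi j hj
    rw [hm j (Set.mem_biUnion hi hj)]
    by_cases hju : j ∈ u
    · rw [hcompat i hi j hju]
      refine ⟨?_, fun h => .inl ⟨hju, h⟩⟩
      rintro (h | ⟨_, _, h, _⟩)
      · exact h.2
      · exact (h.2 hju).elim
    · refine ⟨?_, fun h => .inr ⟨i, hi, ⟨hj, hju⟩, h⟩⟩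
      rintro (h | ⟨i', hi', h, h'⟩)
      · exact (hju h.1).elim
      · rwa [hdisj.elim_set (Finset.mem_coe.2 hi) (Finset.mem_coe.2 hi') j ⟨hj, hju⟩ h]
  refine ⟨m, fun i hi => ⟨(key i hi i (Set.mem_insert _ _)).2 (hH i hi).1, fun h => ?_⟩⟩
  have := (SigmaTerm.mem_eval_iff (hbot i hi) ((hH i hi).2.2.mono Set.subset_union_left)
    fun j hj => key i hi j (Set.mem_insert_of_mem _ hj)).1 h
  exact hbot i hi (hN i ▸ this)

/-- An element `c ≠ ⊤` of `C` above `b` would have a nonzero complement in `C` disjoint from `b`. -/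
theorem upperProj_eq_top {C : BooleanSubalgebra B} {b : B} (hb : b ≠ ⊥)
    (h : ∀ y ∈ C, y ≠ ⊥ → y ≠ ⊤ → y ⊓ b ≠ ⊥) : upperProj C b = ⊤ := by
  refine sInf_eq_top.2 fun c hc => ?_
  by_contra hct
  have hcb : cᶜ ⊓ b = ⊥ := (disjoint_compl_left_iff.2 hc.2).eq_bot
  refine h cᶜ (BooleanSubalgebra.compl_mem hc.1) (by simpa using hct) (fun ht => ?_) hcb
  rw [ht, top_inf_eq] at hcb
  exact hb hcb

theorem SigmaIndependent.not_hasLifting [Nontrivial B] [Nonempty Λ] {A : Λ → Set M}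
    (hA : SigmaIndependent A) {x : Λ → B} (hx : ∀ i, x i ≠ ⊥) {𝒮 : Set (Set Λ)}
    (h𝒮 : ∀ u ∈ 𝒮, u.Countable)
    (hdisj : ∀ U : Λ → Set Λ, (∀ i, i ∈ U i ∧ (U i).Countable) →
      ∃ F : Finset Λ, ∃ u ∈ 𝒮, F.inf x = ⊥ ∧ (∀ i ∈ F, i ∈ U i \ u) ∧
        (F : Set Λ).PairwiseDisjoint (fun i => U i \ u))
    (hind : ∀ u ∈ 𝒮, ∀ i, i ∉ u → ∀ y ∈ completeClosure (x '' u), y ≠ ⊥ → y ≠ ⊤ →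
      y ⊓ x i ≠ ⊥) :
    ¬ HasLifting (termAlgebra A x) (nullIdeal A x) := by
  rintro ⟨g, hg⟩
  let X : Λ → SigmaAlg (termAlgebra A x) := fun i => g (termClass A x (.var i))
  have hX : ∀ i, symmDiff (X i).1 (A i) ∈ nullIdeal A x := fun i =>
    (BoolQuot.mk_eq_mk (J := restrictIdeal (nullIdeal A x) (termAlgebra A x))).1 (DFunLike.congr_fun hg (termClass A x (.var i)))
  choose N hXN hN using hX
  obtain ⟨F, u, hu, hF, hFu, hFd⟩ := hdisj (fun i => insert i (N i).support) fun i =>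
    ⟨Set.mem_insert _ _, (N i).countable_support.insert i⟩
  obtain ⟨m, hm⟩ := hA.exists_mem_and_notMem_eval
    (isCompleteSubalgebra_completeClosure (x '' u)) (h𝒮 u hu)
    (fun j hj => subset_completeClosure _ (Set.mem_image_of_mem x hj))
    (fun i hi => upperProj_eq_top (hx i) (hind u hu i (hFu i hi).2))
    hN hFd
  have hmX : ∀ i ∈ F, m ∈ (X i).1 := by
    intro i hi
    by_contra h
    exact (hm i hi).2 (hXN i (.inr ⟨(hm i hi).1, h⟩))
  have hinf : ∀ F' : Finset Λ, (∀ i ∈ F', m ∈ (X i).1) → m ∈ (F'.inf X).1 := by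
    classical
    intro F'
    induction F' using Finset.induction_on with
    | empty => exact fun _ => Set.mem_univ m
    | insert i F' _ ih =>
      intro h
      rw [Finset.inf_insert]
      exact ⟨h i (Finset.mem_insert_self _ _), ih fun j hj => h j (Finset.mem_insert_of_mem hj)⟩
  -- One term represents both meets, so `F.inf x = ⊥` makes the meet of the classes `⊥`, and `g`
  -- sends it to the empty set, which would contain `m`.
  obtain ⟨c, hcx, hc⟩ := exists_termClass_eq_finset_inf A x F
  rw [hA.termClass_eq_bot_iff.2 (hcx.trans hF)] at hc
  have hbot : F.inf X = ⊥ := by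
    rw [← map_bot g, hc, map_finset_inf]
    rfl
  have := hinf F hmX
  rw [hbot] at this
  exact this

end NoLifting

theorem proposition1p9 {M : Type u} {Λ : Type v}
    {𝔅 : Type w} [CompleteBooleanAlgebra 𝔅]
    (hM : ℵ₀ ≤ #M) (hMω : #M ^ ℵ₀ = #M)
    (hΛ : ℵ₀ ≤ #Λ) (hΛM : Cardinal.lift.{u} #Λ ≤ Cardinal.lift.{v} (2 ^ #M))
    (hccc : BoolCCC 𝔅)
    (x : Λ → 𝔅) (hx : ∀ i, x i ≠ ⊥)
    (𝒮 : Set (Set Λ))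
    (h𝒮 : ∀ u ∈ 𝒮, u.Countable ∧ ∀ i, i ∉ u → x i ∉ completeClosure (x '' u))
    (hdisj : ∀ U : Λ → Set Λ, (∀ i, i ∈ U i ∧ (U i).Countable) →
      ∃ F : Finset Λ, ∃ u ∈ 𝒮,
        F.inf x = ⊥ ∧
        (∀ i ∈ F, i ∈ U i \ u) ∧
        (F : Set Λ).PairwiseDisjoint (fun i => U i \ u))
    (hind : ∀ u ∈ 𝒮, ∀ i, i ∉ u → ∀ y ∈ completeClosure (x '' u), y ≠ ⊥ → y ≠ ⊤ →
      y ⊓ x i ≠ ⊥ ∧ y \ x i ≠ ⊥) :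
    ∃ (I : Order.Ideal (Set M)) (𝔄 : MeasurableSpace M),
      IsSigmaIdeal I ∧ Set.univ ∉ I ∧
      (∀ s ∈ I, MeasurableSet[𝔄] s) ∧
      BoolCCC (SigmaQuot 𝔄 I) ∧
      ¬ HasLifting 𝔄 I := by
  obtain ⟨i⟩ : Nonempty Λ := Cardinal.mk_ne_zero_iff.1 (Cardinal.aleph0_pos.trans_le hΛ).ne'
  have : Nonempty Λ := ⟨i⟩
  have : Nontrivial 𝔅 := ⟨x i, ⊥, hx i⟩
  obtain ⟨A, hA⟩ := exists_sigmaIndependent hM hMω hΛM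
  exact ⟨nullIdeal A x, termAlgebra A x, isSigmaIdeal_nullIdeal, hA.univ_notMem_nullIdeal,
    fun _ => measurableSet_termAlgebra_of_mem, hA.boolCCC hccc,
    hA.not_hasLifting hx (fun u hu => (h𝒮 u hu).1) hdisj
      fun u hu i hi y hy h₀ h₁ => (hind u hu i hi y hy h₀ h₁).1⟩
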